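/- Let $X$ be a metric space and $R$ a ring. For $n\ge 0$ let $C^n(X;R)$ be the $R$-module of all functions $\phi:X^{n+1}\to R$, with coboundary $$(d\phi)(x_0,\dots,x_{n+1})=\sum_{i=0}^{n+1}(-1)^i\phi(x_0,\dots,\widehat{x_i},\dots,x_{n+1}).$$ Equip $X^{n+1}$ with the sup metric, let $\Delta\subset X^{n+1}$ be the diagonal, let $|\phi|=\{\sigma\in X^{n+1}\mid \phi(\sigma)\ne 0\}$, and let $\|\phi\|=\overline{|\phi|}\cap\Delta$. The coarse cochains and the boundedly supported cochains are the subcomplexes $$C_X^n(X;R)=\{\phi\in C^n(X;R)\mid |\phi|\cap N_r(\Delta)\text{ is bounded for every } r\},$$ $$C_b^n(X;R)=\{\phi\in C^n(X;R)\mid \|\phi\|\text{ is bounded}\},$$ with $C_X^*(X;R)\subset C_b^*(X;R)$; their cohomology groups are the coarse cohomology $HX^*(X;R)$ and the boundedly supported cohomology $H_b^*(X;R)$. Call $X$ uniformly contractible at infinity if there are non-decreasing functions $\rho,\mu:[0,\infty)\to[0,\infty)$ and a basepoint $b\in X$ such that every nonempty bounded set $B\subset X$ of diameter $r$ with $d(b,B)\ge\mu(r)$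 is contractible inside a set of diameter at most $\rho(r)$; that is, there is a set $A\supset B$ of diameter at most $\rho(r)$ such that the inclusion $B\hookrightarrow A$ is homotopic, through maps into $A$, to a constant map. **Theorem.** If $X$ is uniformly contractible at infinity, then the inclusion $C_X^*(X;R)\hookrightarrow C_b^*(X;R)$ induces an isomorphism $HX^n(X;R)\cong H_b^n(X;R)$ for every $n\ge 0$. -/

import Mathlib

universe u v

namespace CoarseCohomology

open CategoryTheory Metric Bornology Set
open scoped NNReal

/-- Degree `n` cochains on `X` with coefficients in `R`: arbitrary functions `X ^ (n + 1) → R`. -/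
abbrev Cochain (X : Type u) (R : Type v) (n : ℕ) : Type (max u v) :=
  (Fin (n + 1) → X) → R

/-- The coboundary
`(d φ) (x₀, …, xₙ₊₁) = ∑ i, (-1) ^ i * φ (x₀, …, x̂ᵢ, …, xₙ₊₁)`. -/
def coboundary (X : Type u) (R : Type v) [Ring R] (n : ℕ) :
    Cochain X R n →ₗ[R] Cochain X R (n + 1) where
  toFun φ σ := ∑ i : Fin (n + 2), (-1 : ℤ) ^ (i : ℕ) • φ (fun j => σ (i.succAbove j))
  map_add' φ ψ := by
    funext σ
    simp [smul_add, Finset.sum_add_distrib]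
  map_smul' r φ := by
    funext σ
    simp only [Pi.smul_apply, RingHom.id_apply, Finset.smul_sum]
    exact Finset.sum_congr rfl fun i _ => smul_comm _ _ _

theorem coboundary_coboundary (X : Type u) (R : Type v) [Ring R] (n : ℕ) (φ : Cochain X R n) :
    coboundary X R (n + 1) (coboundary X R n φ) = 0 := by
  funext σ
  simp only [coboundary, LinearMap.coe_mk, AddHom.coe_mk, Finset.smul_sum, smul_smul,
    Pi.zero_apply]
  rw [← Finset.sum_product' (f := fun (i : Fin (n + 3)) (j : Fin (n + 2)) =>
    ((-1 : ℤ) ^ (i : ℕ) * (-1) ^ (j : ℕ)) •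
      φ (fun k => σ (i.succAbove (j.succAbove k)))), Finset.univ_product_univ]
  refine Finset.sum_involution (fun p _ => (p.1.succAbove p.2, p.2.predAbove p.1)) ?_ ?_ ?_ ?_
  · rintro ⟨i, j⟩ -
    simp only [Fin.succAbove_succAbove_succAbove_predAbove]
    rw [← add_smul, ← pow_add, ← pow_add, Fin.neg_one_pow_succAbove_add_predAbove]
    simp
  · rintro ⟨i, j⟩ - - h
    exact Fin.succAbove_ne i j (congrArg Prod.fst h)
  · simp
  · rintro ⟨i, j⟩ -
    simp [Fin.succAbove_succAbove_predAbove, Fin.predAbove_predAbove_succAbove]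

theorem exists_face_mem_support {X : Type u} {R : Type v} [Ring R] {n : ℕ} {φ : Cochain X R n}
    {σ : Fin (n + 2) → X} (h : σ ∈ Function.support (coboundary X R n φ)) :
    ∃ i : Fin (n + 2), (fun j => σ (i.succAbove j)) ∈ Function.support φ := by
  by_contra! hc
  refine h ?_
  simp only [coboundary, LinearMap.coe_mk, AddHom.coe_mk]
  refine Finset.sum_eq_zero fun i _ => ?_
  rw [Function.notMem_support.1 (hc i), smul_zero]

/-- The cochain complex of `R`-modules determined by a family of submodules of the cochain
modules that is stable under the coboundary. -/
noncomputable def subcomplex (X : Type u) (R : Type v) [Ring R]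
    (S : ∀ n, Submodule R (Cochain X R n))
    (hS : ∀ n, ∀ φ ∈ S n, coboundary X R n φ ∈ S (n + 1)) :
    CochainComplex (ModuleCat.{max u v} R) ℕ :=
  CochainComplex.of (fun n => ModuleCat.of R (S n))
    (fun n => ModuleCat.ofHom ((coboundary X R n).restrict (hS n)))
    (fun n => by
      ext φ : 2
      exact Subtype.ext (coboundary_coboundary X R n φ.1))

/-- The inclusion of one such subcomplex into a larger one. -/
noncomputable def subcomplexInclusion (X : Type u) (R : Type v) [Ring R]
    (S T : ∀ n, Submodule R (Cochain X R n))
    (hS : ∀ n, ∀ φ ∈ S n, coboundary X R n φ ∈ S (n + 1))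
    (hT : ∀ n, ∀ φ ∈ T n, coboundary X R n φ ∈ T (n + 1))
    (hST : ∀ n, S n ≤ T n) :
    subcomplex X R S hS ⟶ subcomplex X R T hT :=
  CochainComplex.ofHom (fun n => ModuleCat.ofHom (Submodule.inclusion (hST n)))
    (fun n => by
      simp only [subcomplex, CochainComplex.of_d]
      rfl)

/-- The diagonal of `X ^ (n + 1)`. -/
def diagonal (X : Type u) (n : ℕ) : Set (Fin (n + 1) → X) :=
  range (Function.const (Fin (n + 1)))

/-- The set `‖φ‖`, the intersection of the diagonal with the closure of the support of `φ`
in `X ^ (n + 1)`; the diagonal is identified with `X` by the isometry `x ↦ (x, …, x)`. -/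
def diagSupport {X : Type u} {R : Type v} [Zero R] [TopologicalSpace X] {n : ℕ}
    (φ : Cochain X R n) : Set X :=
  {x | Function.const (Fin (n + 1)) x ∈ closure (Function.support φ)}

section Metric

variable (X : Type u) (R : Type v) [MetricSpace X] [Ring R]

/-- Boundedly supported cochains: those `φ` for which `‖φ‖` is bounded. -/
def boundedCochains (n : ℕ) : Submodule R (Cochain X R n) where
  carrier := {φ | IsBounded (diagSupport φ)}
  zero_mem' := by simp [diagSupport]
  add_mem' {φ ψ} hφ hψ := by
    refine (IsBounded.union hφ hψ).subset fun x hx => ?_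
    have h := closure_mono (Function.support_add φ ψ) hx
    rwa [closure_union] at h
  smul_mem' r φ hφ := by
    refine IsBounded.subset hφ fun x hx => closure_mono ?_ hx
    exact Function.support_const_smul_subset r φ

/-- Coarse cochains: those `φ` whose support meets every `r`-neighbourhood of the diagonal of
`X ^ (n + 1)` (with the sup metric) in a bounded set. -/
def coarseCochains (n : ℕ) : Submodule R (Cochain X R n) where
  carrier := {φ | ∀ r : ℝ, IsBounded (Function.support φ ∩ thickening r (diagonal X n))}
  zero_mem' := by simp
  add_mem' {φ ψ} hφ hψ r := by
    refine ((hφ r).union (hψ r)).subset ?_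
    rw [← union_inter_distrib_right]
    exact inter_subset_inter_left _ (Function.support_add φ ψ)
  smul_mem' r φ hφ s :=
    (hφ s).subset (inter_subset_inter_left _ (Function.support_const_smul_subset r φ))

theorem coboundary_mem_boundedCochains (n : ℕ) (φ : Cochain X R n)
    (hφ : φ ∈ boundedCochains X R n) : coboundary X R n φ ∈ boundedCochains X R (n + 1) := by
  refine IsBounded.subset hφ fun x hx => ?_
  let F : Fin (n + 2) → (Fin (n + 2) → X) → (Fin (n + 1) → X) :=
    fun i σ j => σ (i.succAbove j)
  have hF : ∀ i, Continuous (F i) := fun i => by fun_prop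
  have h1 : Function.support (coboundary X R n φ) ⊆ ⋃ i, F i ⁻¹' Function.support φ :=
    fun σ hσ => mem_iUnion.2 (exists_face_mem_support hσ)
  have h2 := closure_mono h1 hx
  rw [closure_iUnion_of_finite] at h2
  obtain ⟨i, hi⟩ := mem_iUnion.1 h2
  exact (hF i).closure_preimage_subset _ hi

theorem mem_thickening_diagonal {n : ℕ} {r : ℝ} {σ : Fin (n + 1) → X} :
    σ ∈ thickening r (diagonal X n) ↔ ∃ x : X, ∀ i, dist (σ i) x < r := by
  simp only [mem_thickening_iff, diagonal, exists_range_iff]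
  refine exists_congr fun x => ⟨fun h i => (dist_le_pi_dist _ _ i).trans_lt h, fun h => ?_⟩
  exact (dist_pi_lt_iff (dist_nonneg.trans_lt (h 0))).2 h

theorem coboundary_mem_coarseCochains (n : ℕ) (φ : Cochain X R n)
    (hφ : φ ∈ coarseCochains X R n) : coboundary X R n φ ∈ coarseCochains X R (n + 1) := by
  intro r
  rcases isEmpty_or_nonempty X with hX | ⟨⟨b⟩⟩
  · exact (Set.toFinite _).isBounded
  obtain ⟨C, hC⟩ := (hφ r).subset_closedBall (Function.const _ b)
  refine (isBounded_closedBall (x := Function.const (Fin (n + 2)) b)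
    (r := r + r + C)).subset ?_
  rintro σ ⟨hσ, hr⟩
  obtain ⟨i, hi⟩ := exists_face_mem_support hσ
  obtain ⟨x, hx⟩ := (mem_thickening_diagonal X).1 hr
  have hm := hC ⟨hi, (mem_thickening_diagonal X).2 ⟨x, fun j => hx _⟩⟩
  have h0 : dist (σ (i.succAbove 0)) b ≤ C := (dist_le_pi_dist _ _ 0).trans hm
  have key : ∀ k, dist (σ k) b ≤ r + r + C := fun k => by
    have h1 := dist_triangle4 (σ k) x (σ (i.succAbove 0)) b
    have h2 := hx k
    have h3 := hx (i.succAbove 0)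
    rw [dist_comm] at h3
    linarith
  exact (dist_pi_le_iff (dist_nonneg.trans (key 0))).2 key

theorem coarseCochains_le_boundedCochains (n : ℕ) :
    coarseCochains X R n ≤ boundedCochains X R n := by
  intro φ hφ
  rcases isEmpty_or_nonempty X with hX | ⟨⟨b⟩⟩
  · exact (Set.toFinite _).isBounded
  obtain ⟨C, hC⟩ := (hφ 1).subset_closedBall (Function.const _ b)
  refine (isBounded_closedBall (x := b) (r := 1 + C)).subset fun x hx => ?_
  obtain ⟨σ, hσ, hd⟩ := Metric.mem_closure_iff.1 hx 1 one_pos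
  have hs : ∀ j, dist (σ j) x < 1 := fun j => by
    rw [dist_comm]
    exact (dist_le_pi_dist (Function.const _ x) σ j).trans_lt hd
  have hm := hC ⟨hσ, (mem_thickening_diagonal X).2 ⟨x, hs⟩⟩
  have h0 : dist (σ 0) b ≤ C := (dist_le_pi_dist _ _ 0).trans hm
  have h1 := dist_triangle x (σ 0) b
  have h2 := hs 0
  rw [dist_comm] at h2
  exact mem_closedBall.2 (by linarith)

/-- The complex of coarse cochains; its cohomology is the coarse cohomology of `X`. -/
noncomputable def coarseComplex : CochainComplex (ModuleCat.{max u v} R) ℕ :=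
  subcomplex X R (coarseCochains X R) (coboundary_mem_coarseCochains X R)

/-- The complex of boundedly supported cochains; its cohomology is the boundedly supported
cohomology of `X`. -/
noncomputable def boundedComplex : CochainComplex (ModuleCat.{max u v} R) ℕ :=
  subcomplex X R (boundedCochains X R) (coboundary_mem_boundedCochains X R)

/-- The inclusion of the coarse cochains into the boundedly supported cochains. -/
noncomputable def coarseInclusion : coarseComplex X R ⟶ boundedComplex X R :=
  subcomplexInclusion X R _ _ (coboundary_mem_coarseCochains X R)
    (coboundary_mem_boundedCochains X R) (coarseCochains_le_boundedCochains X R)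

/-- `X` is uniformly contractible at infinity: there are non-decreasing control functions
`ρ`, `μ` and a basepoint `b` such that every (nonempty, bounded) set `B` of diameter `r` with
`d (b, B) ≥ μ r` is contractible inside some set `A` of diameter at most `ρ r`, that is, the
inclusion `B ↪ A` is homotopic, as a map into `A`, to a constant map. -/
def UniformlyContractibleAtInfinity : Prop :=
  ∃ (ρ μ : ℝ≥0 → ℝ≥0) (b : X), Monotone ρ ∧ Monotone μ ∧
    ∀ (r : ℝ≥0) (B : Set X), B.Nonempty → IsBounded B → diam B = r → μ r ≤ infDist b B →
      ∃ (A : Set X) (hBA : B ⊆ A), IsBounded A ∧ diam A ≤ ρ r ∧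
        (ContinuousMap.inclusion hBA).Nullhomotopic

end Metric

end CoarseCohomology

/-! The statement amounts to the acyclicity of the quotient of the boundedly supported cochains by
the coarse ones. It is read off from a double complex between the two: functions `f x y` of two
finite lists, modulo those that are `Negligible`. With `x` empty, negligible means boundedly
supported; with `y` empty, it means coarse. A list of length `n + 1` has degree `n`, so admitting
empty lists augments the complex.

For `y` nonempty the first direction is exact (`exists_sub_listDx_negligible`): cone off `x` from a
vertex depending on `y`. For `x` nonempty the second direction is exact
(`UniformlyContractibleAtInfinity.exists_sub_listDy_negligible`): a ball around the first entry of
`x` contracts in a bounded set on which `f x` is locally a cocycle, and homotopy invariance yields a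
primitive. This is where the hypothesis on `X` enters.

If `φ` is boundedly supported with coarse coboundary, then `φ (x ++ y)` is a total cocycle modulo
negligible functions. One staircase gives a primitive modulo coarse cochains, and a second makes
that primitive boundedly supported (`exists_sub_listD_negligible`). -/

namespace CoarseCohomology

open CategoryTheory Metric Bornology Set
open scoped NNReal

/-! ### Cochains on lists, the double complex and the prism operator -/

section ListCochains

variable {X Y M : Type*} [AddCommGroup M]

/-- The coboundary of a function on finite lists, `(d f) (x :: l) = f l - d (f (x :: ·)) l`. -/
def listD : (List X → M) → List X → M
  | _, [] => 0
  | f, x :: l => f l - listD (fun m => f (x :: m)) l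

@[simp] theorem listD_nil (f : List X → M) : listD f [] = 0 := rfl

theorem listD_cons (f : List X → M) (x : X) (l : List X) :
    listD f (x :: l) = f l - listD (fun m => f (x :: m)) l := rfl

theorem listD_sub (f g : List X → M) (l : List X) :
    listD (fun m => f m - g m) l = listD f l - listD g l := by
  induction l generalizing f g with
  | nil => simp
  | cons x l ih => simp only [listD_cons, ih]; abel

theorem listD_zero (l : List X) : listD (fun _ => (0 : M)) l = 0 := by
  induction l with
  | nil => simp
  | cons x l ih => simp [listD_cons, ih]

theorem listD_add (f g : List X → M) (l : List X) :
    listD (fun m => f m + g m) l = listD f l + listD g l := by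
  induction l generalizing f g with
  | nil => simp
  | cons x l ih => simp only [listD_cons, ih]; abel

theorem listD_zsmul (k : ℤ) (f : List X → M) (l : List X) :
    listD (fun m => k • f m) l = k • listD f l := by
  induction l generalizing f with
  | nil => simp
  | cons x l ih => simp only [listD_cons, ih, smul_sub]

theorem listD_sum {ι : Type*} (s : Finset ι) (f : ι → List X → M) (l : List X) :
    listD (fun m => ∑ i ∈ s, f i m) l = ∑ i ∈ s, listD (f i) l := by
  classical
  induction s using Finset.induction_on with
  | empty => simp [listD_zero]
  | insert a s ha ih => simp [Finset.sum_insert ha, listD_add, ih]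

theorem listD_eq_zero {f : List X → M} {l : List X}
    (h : ∀ m, m.Sublist l → m.length + 1 = l.length → f m = 0) : listD f l = 0 := by
  induction l generalizing f with
  | nil => simp
  | cons x l ih =>
    rw [listD_cons, h l (List.sublist_cons_self x l) rfl, ih, sub_zero]
    exact fun m hm hl => h _ (hm.cons_cons x) (by simpa using hl)

theorem listD_congr {f g : List X → M} {l : List X}
    (h : ∀ m, m.Sublist l → m.length + 1 = l.length → f m = g m) : listD f l = listD g l := by
  rw [← sub_eq_zero, ← listD_sub]
  exact listD_eq_zero fun m hm hl => sub_eq_zero.2 (h m hm hl)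

theorem listD_listD (f : List X → M) (l : List X) : listD (listD f) l = 0 := by
  induction l generalizing f with
  | nil => simp
  | cons x l ih =>
    have : (fun m => listD f (x :: m)) = fun m => f m - listD (fun m' => f (x :: m')) m := rfl
    rw [listD_cons, this, listD_sub, ih]
    abel

/-- A face of `l ++ m` deletes an entry of `l`, or one of `m` with its sign shifted by the length of
`l`. Thus `f ↦ f (x ++ y)` intertwines `listD` with the total coboundary. -/
theorem listD_append (f : List X → M) (l m : List X) :
    listD f (l ++ m) = listD (fun l' => f (l' ++ m)) l
      + (-1 : ℤ) ^ l.length • listD (fun m' => f (l ++ m')) m := by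
  induction l generalizing f with
  | nil => simp
  | cons x l ih =>
    simp only [List.cons_append, listD_cons, ih, List.length_cons, pow_succ, mul_neg, mul_one,
      neg_smul]
    abel

theorem listD_map (f : List X → M) (π : Y → X) (l : List Y) :
    listD (fun m => f (m.map π)) l = listD f (l.map π) := by
  induction l generalizing f with
  | nil => simp
  | cons x l ih => simp only [List.map_cons, listD_cons, ← ih]

theorem listD_sign_smul (f : List X → M) (l : List X) :
    listD (fun m => (-1 : ℤ) ^ m.length • f m) l = -((-1 : ℤ) ^ l.length • listD f l) := by
  rcases l with - | ⟨x, l⟩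
  · simp
  rw [listD_congr (g := fun m => (-1 : ℤ) ^ l.length • f m), listD_zsmul]
  · simp [pow_succ]
  · intro m _ hm
    simp only [List.length_cons, Nat.add_right_cancel_iff] at hm
    rw [hm]

/-- The coboundary in the first variable. -/
def listDx (f : List X → List X → M) (x y : List X) : M := listD (fun x' => f x' y) x

/-- The coboundary in the second variable. -/
def listDy (f : List X → List X → M) (x y : List X) : M := listD (f x) y

/-- The total coboundary of a function of two lists. -/
def listTot (f : List X → List X → M) (x y : List X) : M :=
  listDx f x y + (-1 : ℤ) ^ x.length • listDy f x y

theorem listDx_listDy (f : List X → List X → M) (x y : List X) :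
    listDx (listDy f) x y = listDy (listDx f) x y := by
  unfold listDx listDy
  induction x generalizing f with
  | nil => simp [listD_zero]
  | cons a l ih =>
    simp only [listD_cons, listD_sub]
    rw [ih (fun x' => f (a :: x'))]

theorem listTot_listTot (f : List X → List X → M) (x y : List X) :
    listTot (listTot f) x y = 0 := by
  have h1 : listDx (listTot f) x y = -((-1 : ℤ) ^ x.length • listDx (listDy f) x y) := by
    simp only [listDx, listTot]
    rw [listD_add, listD_sign_smul (fun x' => listDy f x' y), listD_listD, zero_add]
  have h2 : listDy (listTot f) x y = listDy (listDx f) x y := by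
    change listD (fun b => listDx f x b + (-1 : ℤ) ^ x.length • listDy f x b) y = _
    rw [listD_add, listD_zsmul]
    unfold listDy
    rw [listD_listD, smul_zero, add_zero]
  rw [listTot, h1, h2, listDx_listDy]
  abel

theorem listTot_sub (f g : List X → List X → M) (x y : List X) :
    listTot (fun a b => f a b - g a b) x y = listTot f x y - listTot g x y := by
  simp only [listTot, listDx, listDy, listD_sub, smul_sub]
  abel

theorem listTot_add (f g : List X → List X → M) (x y : List X) :
    listTot (fun a b => f a b + g a b) x y = listTot f x y + listTot g x y := by
  simp only [listTot, listDx, listDy, listD_add, smul_add]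
  abel

theorem listTot_append (f : List X → M) (x y : List X) :
    listTot (fun a b => f (a ++ b)) x y = listD f (x ++ y) :=
  (listD_append f x y).symm

/-- The prism operator of two maps `α`, `β`, summing only over the vertices on which `α` and `β`
differ. -/
noncomputable def listPrism (α β : Y → X) : (List X → M) → List Y → M
  | _, [] => 0
  | g, y :: l => open Classical in (if α y = β y then 0 else g (α y :: β y :: l.map β))
      - listPrism α β (fun m => g (α y :: m)) l

theorem listPrism_eq_zero {α β : Y → X} {U : Set X} {g : List X → M} {l : List Y}
    (hg : ∀ m : List X, m.length = l.length + 1 → (∀ x ∈ m, x ∈ U) → g m = 0)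
    (hα : ∀ y ∈ l, α y ∈ U) (hβ : ∀ y ∈ l, β y ∈ U) : listPrism α β g l = 0 := by
  induction l generalizing g with
  | nil => rfl
  | cons y l ih =>
    simp only [List.mem_cons, forall_eq_or_imp] at hα hβ
    rw [listPrism, ih, hg]
    · simp
    · simp
    · simpa using ⟨hα.1, hβ⟩
    · exact fun m hm hU => hg _ (by simpa using hm) (by simpa using ⟨hα.1, hU⟩)
    · exact hα.2
    · exact hβ.2

theorem listPrism_self {α β : Y → X} {g : List X → M} {l : List Y}
    (h : ∀ y ∈ l, α y = β y) : listPrism α β g l = 0 := by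
  induction l generalizing g with
  | nil => rfl
  | cons y l ih =>
    simp only [List.mem_cons, forall_eq_or_imp] at h
    simp [listPrism, h.1, ih h.2]

theorem listPrism_congr {α β α' β' : Y → X} {g : List X → M} {l : List Y}
    (hα : ∀ y ∈ l, α y = α' y) (hβ : ∀ y ∈ l, β y = β' y) :
    listPrism α β g l = listPrism α' β' g l := by
  induction l generalizing g with
  | nil => rfl
  | cons y l ih =>
    simp only [List.mem_cons, forall_eq_or_imp] at hα hβ
    rw [listPrism, listPrism, hα.1, hβ.1, ih hα.2 hβ.2, List.map_congr_left hβ.2]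

theorem listPrism_sub (α β : Y → X) (f g : List X → M) (l : List Y) :
    listPrism α β (fun m => f m - g m) l = listPrism α β f l - listPrism α β g l := by
  induction l generalizing f g with
  | nil => simp [listPrism]
  | cons y l ih =>
    simp only [listPrism, ih]
    split_ifs <;> abel

/-- The usual prism homotopy. A term at a vertex `y` contributes in all a difference of values of
`g` on two lists that differ only in `α y` and `β y`, so omitting it when these agree is harmless.
-/
theorem listD_listPrism (α β : Y → X) (g : List X → M) (l : List Y) :
    listD (listPrism α β g) l + listPrism α β (listD g) l
      = g (l.map β) - g (l.map α) := by
  induction l generalizing g with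
  | nil => simp [listPrism]
  | cons y l ih =>
    have h1 : (fun m => listPrism α β g (y :: m)) = fun m =>
        (open Classical in if α y = β y then 0 else g (α y :: β y :: m.map β))
          - listPrism α β (fun m' => g (α y :: m')) m := rfl
    have h2 : (fun m => listD g (α y :: m)) = fun m => g m - listD (fun m' => g (α y :: m')) m :=
      rfl
    have h3 := ih (fun m => g (α y :: m))
    have h4 := listD_map (fun m => g (α y :: β y :: m)) β l
    rw [listD_cons, h1, listD_sub, listPrism, h2, listPrism_sub]
    simp only [List.map_cons] at h3 ⊢
    rw [← sub_eq_iff_eq_add.2 h3.symm]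
    split_ifs with h
    · rw [listD_zero, h]; abel
    · rw [h4, listD_cons, listD_cons]; abel

end ListCochains

/-! ### Negligible functions, row exactness and the two staircases -/

section Negligible

variable {X M : Type*} [MetricSpace X] [AddCommGroup M]

/-- `g` vanishes on the lists of length `q` close to `z`. -/
def VanishesNear (q : ℕ) (z : X) (g : List X → M) : Prop :=
  ∃ ε > 0, ∀ y : List X, y.length = q → (∀ w ∈ y, dist w z < ε) → g y = 0

/-- For all `r` and all `z` far away from `b`, and all lists `x` of length `p` in the `r`-ball
around `z`, the function `f x` vanishes on the lists of length `q` close to `z`. -/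
def Negligible (b : X) (p q : ℕ) (f : List X → List X → M) : Prop :=
  ∀ r : ℝ, ∃ C : ℝ, ∀ z, C ≤ dist z b → ∀ x : List X, x.length = p →
    (∀ w ∈ x, dist w z < r) → VanishesNear q z (f x)

theorem VanishesNear.sub {q : ℕ} {z : X} {f g : List X → M} (hf : VanishesNear q z f)
    (hg : VanishesNear q z g) : VanishesNear q z (fun y => f y - g y) := by
  obtain ⟨ε, hε, h⟩ := hf
  obtain ⟨δ, hδ, h'⟩ := hg
  refine ⟨min ε δ, lt_min hε hδ, fun y hy hw => ?_⟩
  beta_reduce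
  rw [h y hy fun w hw' => (hw w hw').trans_le (min_le_left _ _),
    h' y hy fun w hw' => (hw w hw').trans_le (min_le_right _ _), sub_zero]

theorem VanishesNear.congr {q : ℕ} {z : X} {f g : List X → M} (hf : VanishesNear q z f)
    (h : ∀ y, y.length = q → g y = f y) : VanishesNear q z g := by
  obtain ⟨ε, hε, h'⟩ := hf
  exact ⟨ε, hε, fun y hy hw => (h y hy).trans (h' y hy hw)⟩

theorem VanishesNear.listD {q : ℕ} {z : X} {f : List X → M} (hf : VanishesNear q z f) :
    VanishesNear (q + 1) z (listD f) := by
  obtain ⟨ε, hε, h⟩ := hf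
  refine ⟨ε, hε, fun y hy hw => listD_eq_zero fun m hm hl => h m (by omega) fun w hw' => ?_⟩
  exact hw w (hm.subset hw')

/-- The radius in `VanishesNear` depends on the function; only finitely many radii are sure to have
a positive minimum. -/
theorem exists_uniform_of_vanishesNear {ι : Type*} {s : Set ι} (hs : s.Finite) {q : ℕ} {z : X}
    {f : ι → List X → M} (h : ∀ i ∈ s, VanishesNear q z (f i)) :
    ∃ ε > 0, ∀ i ∈ s, ∀ y : List X, y.length = q → (∀ w ∈ y, dist w z < ε) → f i y = 0 := by
  induction s, hs using Set.Finite.induction_on with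
  | empty => exact ⟨1, one_pos, by simp⟩
  | @insert a s _ _ ih =>
    obtain ⟨ε, hε, h1⟩ := ih fun i hi => h i (mem_insert_of_mem _ hi)
    obtain ⟨δ, hδ, h2⟩ := h a (mem_insert _ _)
    refine ⟨min ε δ, lt_min hε hδ, ?_⟩
    rintro i (rfl | hi) y hy hw
    · exact h2 y hy fun w hw' => (hw w hw').trans_le (min_le_right _ _)
    · exact h1 i hi y hy fun w hw' => (hw w hw').trans_le (min_le_left _ _)

namespace Negligible

variable {b : X} {p q : ℕ} {f g : List X → List X → M}

theorem sub (hf : Negligible b p q f) (hg : Negligible b p q g) :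
    Negligible b p q (fun x y => f x y - g x y) := by
  intro r
  obtain ⟨C, hC⟩ := hf r
  obtain ⟨D, hD⟩ := hg r
  exact ⟨max C D, fun z hz x hx hr => (hC z ((le_max_left _ _).trans hz) x hx hr).sub
    (hD z ((le_max_right _ _).trans hz) x hx hr)⟩

theorem congr (hf : Negligible b p q f)
    (h : ∀ x y, x.length = p → y.length = q → g x y = f x y) : Negligible b p q g := by
  intro r
  obtain ⟨C, hC⟩ := hf r
  exact ⟨C, fun z hz x hx hr => (hC z hz x hx hr).congr fun y hy => h x y hx hy⟩

theorem zero : Negligible b p q (fun _ _ => (0 : M)) :=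
  fun _ => ⟨0, fun _ _ _ _ _ => ⟨1, one_pos, fun _ _ _ => rfl⟩⟩

theorem neg (hf : Negligible b p q f) : Negligible b p q (fun x y => -f x y) :=
  (zero.sub hf).congr fun _ _ _ _ => (zero_sub _).symm

theorem listDy (hf : Negligible b p q f) : Negligible b p (q + 1) (listDy f) := by
  intro r
  obtain ⟨C, hC⟩ := hf r
  exact ⟨C, fun z hz x hx hr => (hC z hz x hx hr).listD⟩

theorem listDx (hf : Negligible b p q f) : Negligible b (p + 1) q (listDx f) := by
  intro r
  obtain ⟨C, hC⟩ := hf r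
  refine ⟨C, fun z hz x hx hr => ?_⟩
  have hs : {m : List X | m.Sublist x ∧ m.length + 1 = x.length}.Finite :=
    (List.finite_toSet x.sublists).subset fun m hm => List.mem_sublists.2 hm.1
  obtain ⟨ε, hε, h⟩ := exists_uniform_of_vanishesNear hs (q := q) (z := z) (f := f) fun m hm =>
    hC z hz m (by have := hm.2; omega) fun w hw => hr w (hm.1.subset hw)
  exact ⟨ε, hε, fun y hy hw => listD_eq_zero fun m hm hl => h m ⟨hm, hl⟩ y hy hw⟩

theorem sign_smul (hf : Negligible b p q f) :
    Negligible b p q (fun x y => (-1 : ℤ) ^ x.length • f x y) := by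
  rcases neg_one_pow_eq_or ℤ p with h | h
  · exact hf.congr fun x y hx _ => by simp [hx, h]
  · exact hf.neg.congr fun x y hx _ => by simp [hx, h]

/-- A function of lists that vanishes on the lists of bounded diameter far away gives a negligible
function of two lists. -/
theorem append {φ : List X → M} {n : ℕ} (hφ : Negligible b n 0 (fun x _ => φ x))
    (hn : p + q = n) : Negligible b p q (fun x y => φ (x ++ y)) := by
  intro r
  obtain ⟨C, hC⟩ := hφ (max r 1)
  refine ⟨C, fun z hz x hx hr => ⟨1, one_pos, fun y hy hw => ?_⟩⟩
  obtain ⟨ε, -, h⟩ := hC z hz (x ++ y) (by simp [hx, hy, hn]) fun w hw' => by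
    rcases List.mem_append.1 hw' with h | h
    · exact (hr w h).trans_le (le_max_left _ _)
    · exact (hw w h).trans_le (le_max_right _ _)
  exact h [] rfl (by simp)

end Negligible

-- Paracompactness: `c x` indexes a member containing `x` of a locally finite refinement of the
-- cover by unit balls.
variable (X) in
theorem exists_locally_finite_valued_approximation :
    ∃ c : X → X, (∀ x, dist (c x) x < 1) ∧ ∀ z, ∃ ε > 0, (c '' ball z ε).Finite := by
  obtain ⟨v, hvo, hvu, hvf, hv⟩ := precise_refinement (fun x : X => ball x 1)
    (fun x => isOpen_ball) (eq_univ_of_forall fun x => mem_iUnion.2 ⟨x, mem_ball_self one_pos⟩)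
  have h : ∀ x, ∃ i, x ∈ v i := fun x => mem_iUnion.1 (hvu ▸ mem_univ x)
  choose c hc using h
  refine ⟨c, fun x => by simpa [dist_comm] using hv _ (hc x), fun z => ?_⟩
  obtain ⟨t, ht, hf⟩ := hvf z
  obtain ⟨ε, hε, hb⟩ := Metric.mem_nhds_iff.1 ht
  refine ⟨ε, hε, hf.subset ?_⟩
  rintro _ ⟨x, hx, rfl⟩
  exact ⟨x, hc x, hb hx⟩

/-- Exactness in the first variable. -/
theorem exists_sub_listDx_negligible {b : X} {p q : ℕ} {f : List X → List X → M}
    (hf : Negligible b (p + 1) (q + 1) (listDx f)) :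
    ∃ ψ : List X → List X → M, Negligible b p (q + 1) (fun x y => f x y - listDx ψ x y) := by
  obtain ⟨c, hc, hfin⟩ := exists_locally_finite_valued_approximation X
  rcases isEmpty_or_nonempty X with hX | ⟨⟨x0⟩⟩
  · exact (hX.false b).elim
  -- With `s = c w` for the first entry `w` of `y`, the error `f x y - listDx ψ x y` equals `listDx
  -- f (s :: x) y`. Near `z` only finitely many `s` occur, so one radius serves them all.
  refine ⟨fun x y => f (c (y.headD x0) :: x) y, fun r => ?_⟩
  -- The `2` is for `c w`: within `1` of `w`, which is within `1` of `z`.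
  obtain ⟨C, hC⟩ := hf (max r 2)
  refine ⟨C, fun z hz x hx hr => ?_⟩
  obtain ⟨δ, hδ, hs⟩ := hfin z
  have hs' : (c '' ball z (min δ 1)).Finite :=
    hs.subset (image_mono (ball_subset_ball (min_le_left _ _)))
  obtain ⟨ε, hε, h⟩ := exists_uniform_of_vanishesNear hs' (q := q + 1) (z := z)
    (f := fun s => listDx f (s :: x)) (by
      rintro _ ⟨w, hw, rfl⟩
      refine hC z hz _ (by simp [hx]) ?_
      have h1 : dist (c w) z < 2 := by
        have := dist_triangle (c w) w z
        have := hc w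
        have := (mem_ball.1 hw).trans_le (min_le_right _ _)
        linarith
      simpa using ⟨Or.inr h1, fun w hw => Or.inl (hr w hw)⟩)
  refine ⟨min ε (min δ 1), by positivity, fun y hy hw => ?_⟩
  rcases y with - | ⟨w, y⟩
  · simp at hy
  refine h (c w) ⟨w, ?_, rfl⟩ (w :: y) hy fun w' hw' => (hw w' hw').trans_le (min_le_left _ _)
  exact (hw w (by simp)).trans_le (min_le_right _ _)

/-- If the second variable is exact, then a function of two lists that is a cocycle for the total
coboundary up to negligible functions and vanishes in bidegree `(0, n + 1)` is a coboundary. -/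
theorem exists_sub_listTot_negligible_of_zero_left {b : X} {n : ℕ} {f : List X → List X → M}
    (hcol : ∀ (p q : ℕ) (f : List X → List X → M), Negligible b (p + 1) (q + 1) (listDy f) →
      ∃ ψ : List X → List X → M, Negligible b (p + 1) q (fun x y => f x y - listDy ψ x y))
    (h0 : Negligible b 0 (n + 1) f)
    (hf : ∀ p q, p + q = n + 2 → Negligible b p q (listTot f)) :
    ∃ θ : List X → List X → M, (∀ y, θ [] y = 0) ∧
      ∀ p q, p + q = n + 1 → Negligible b p q (fun x y => f x y - listTot θ x y) := by
  suffices H : ∀ k ≤ n + 1, ∃ θ : List X → List X → M, (∀ y, θ [] y = 0) ∧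
      ∀ p q, p + q = n + 1 → p ≤ k → Negligible b p q (fun x y => f x y - listTot θ x y) by
    obtain ⟨θ, h1, h2⟩ := H (n + 1) le_rfl
    exact ⟨θ, h1, fun p q h => h2 p q h (by omega)⟩
  intro k
  induction k with
  | zero =>
    refine fun _ => ⟨fun _ _ => 0, fun _ => rfl, fun p q hpq hp => ?_⟩
    obtain rfl : p = 0 := by omega
    obtain rfl : q = n + 1 := by omega
    exact h0.congr fun x y _ _ => by simp [listTot, listDx, listDy, listD_zero]
  | succ k ih =>
    intro hk
    obtain ⟨θ, hθ, h⟩ := ih (by omega)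
    obtain ⟨q, rfl⟩ : ∃ q, n = k + q := ⟨n - k, by omega⟩
    set g : List X → List X → M := fun x y => f x y - listTot θ x y with hg
    have hTot : ∀ x y, listTot g x y = listTot f x y := fun x y => by
      rw [hg, listTot_sub, listTot_listTot, sub_zero]
    have hgk : Negligible b k (q + 1) g := h k (q + 1) (by omega) le_rfl
    -- The total coboundary of `g` is negligible here, and so is its `listDx` part, since `g` is
    -- negligible one column earlier.
    have hgy : Negligible b (k + 1) (q + 1) (listDy g) := by
      have h1 := ((hf (k + 1) (q + 1) (by omega)).sub hgk.listDx).sign_smul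
      refine h1.congr fun x y _ _ => ?_
      rw [← hTot, listTot, add_sub_cancel_left, smul_smul, ← mul_pow]
      simp
    obtain ⟨ψ, hψ⟩ := hcol k q g hgy
    -- Confined to one first degree, `χ` leaves the columns already treated untouched; its sign
    -- cancels the one in `listTot`.
    set χ : List X → List X → M := fun x y =>
      if x.length = k + 1 then (-1 : ℤ) ^ x.length • ψ x y else 0 with hχ
    have hχy : ∀ x y, listDy χ x y =
        if x.length = k + 1 then (-1 : ℤ) ^ x.length • listDy ψ x y else 0 := fun x y => by
      by_cases hx : x.length = k + 1
      · simp [listDy, hχ, hx, listD_zsmul]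
      · simp [listDy, hχ, hx, listD_zero]
    have hχx : ∀ x y, x.length ≤ k + 1 → listDx χ x y = 0 := fun x y hx =>
      listD_eq_zero fun m _ hl => if_neg (by omega)
    refine ⟨fun x y => θ x y + χ x y, fun y => by simp [hθ, hχ], fun p q' hpq hp => ?_⟩
    rcases Nat.lt_or_ge k p with hkp | hkp
    · obtain rfl : p = k + 1 := by omega
      obtain rfl : q' = q := by omega
      refine hψ.congr fun x y hx _ => ?_
      rw [listTot_add, ← sub_sub]
      change g x y - _ = _
      rw [listTot, hχx x y hx.le, hχy, if_pos hx, smul_smul, ← mul_pow]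
      simp
    · refine (h p q' hpq hkp).congr fun x y hx _ => ?_
      have h0 : listTot χ x y = 0 := by
        rw [listTot, hχx x y (by omega), hχy, if_neg (by omega), smul_zero, add_zero]
      rw [listTot_add, h0, add_zero]

/-- Exactness in the first variable: a function of two lists that is a cocycle for the total
coboundary up to negligible functions and vanishes in bidegree `(n, 0)` is a coboundary. -/
theorem exists_sub_listTot_negligible_of_zero_right {b : X} {n : ℕ} {f : List X → List X → M}
    (h0 : Negligible b n 0 f)
    (hf : ∀ p q, p + q = n + 1 → Negligible b p q (listTot f)) :
    ∃ θ : List X → List X → M,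
      ∀ p q, p + q = n → Negligible b p q (fun x y => f x y - listTot θ x y) := by
  suffices H : ∀ k ≤ n, ∃ θ : List X → List X → M,
      ∀ p q, p + q = n → q ≤ k → Negligible b p q (fun x y => f x y - listTot θ x y) by
    obtain ⟨θ, h2⟩ := H n le_rfl
    exact ⟨θ, fun p q h => h2 p q h (by omega)⟩
  intro k
  induction k with
  | zero =>
    refine fun _ => ⟨fun _ _ => 0, fun p q hpq hq => ?_⟩
    obtain rfl : q = 0 := by omega
    obtain rfl : p = n := by omega
    exact h0.congr fun x y _ _ => by simp [listTot, listDx, listDy, listD_zero]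
  | succ k ih =>
    intro hk
    obtain ⟨θ, h⟩ := ih (by omega)
    obtain ⟨p, rfl⟩ : ∃ p, n = p + 1 + k := ⟨n - k - 1, by omega⟩
    set g : List X → List X → M := fun x y => f x y - listTot θ x y with hg
    have hTot : ∀ x y, listTot g x y = listTot f x y := fun x y => by
      rw [hg, listTot_sub, listTot_listTot, sub_zero]
    have hgk : Negligible b (p + 1) k g := h (p + 1) k (by omega) le_rfl
    have hgx : Negligible b (p + 1) (k + 1) (listDx g) := by
      refine ((hf (p + 1) (k + 1) (by omega)).sub hgk.listDy.sign_smul).congr fun x y _ _ => ?_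
      rw [← hTot, listTot, add_sub_cancel_right]
    obtain ⟨ψ, hψ⟩ := exists_sub_listDx_negligible hgx
    set χ : List X → List X → M := fun x y => if y.length = k + 1 then ψ x y else 0 with hχ
    have hχx : ∀ x y, listDx χ x y = if y.length = k + 1 then listDx ψ x y else 0 := fun x y => by
      by_cases hy : y.length = k + 1
      · simp [listDx, hχ, hy]
      · simp [listDx, hχ, hy, listD_zero]
    have hχy : ∀ x y, y.length ≤ k + 1 → listDy χ x y = 0 := fun x y hx =>
      listD_eq_zero fun m _ hl => if_neg (by omega)
    refine ⟨fun x y => θ x y + χ x y, fun p' q hpq hq => ?_⟩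
    rcases Nat.lt_or_ge k q with hkp | hkp
    · obtain rfl : q = k + 1 := by omega
      obtain rfl : p' = p := by omega
      refine hψ.congr fun x y _ hy => ?_
      rw [listTot_add, ← sub_sub]
      change g x y - _ = _
      rw [listTot, hχy x y hy.le, hχx, if_pos hy]
      simp
    · refine (h p' q hpq hkp).congr fun x y _ hy => ?_
      have h0 : listTot χ x y = 0 := by
        rw [listTot, hχy x y (by omega), hχx, if_neg (by omega), smul_zero, add_zero]
      rw [listTot_add, h0, add_zero]

/-- If the second variable is exact, then a cochain that vanishes near the diagonal far away, and
whose coboundary vanishes on the lists of bounded diameter far away, differs from such a cochain by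
the coboundary of a cochain that vanishes near the diagonal far away. -/
theorem exists_sub_listD_negligible {b : X} {n : ℕ} {φ : List X → M}
    (hcol : ∀ (p q : ℕ) (f : List X → List X → M), Negligible b (p + 1) (q + 1) (listDy f) →
      ∃ ψ : List X → List X → M, Negligible b (p + 1) q (fun x y => f x y - listDy ψ x y))
    (hφ : Negligible b 0 (n + 1) (fun _ y => φ y))
    (hdφ : Negligible b (n + 2) 0 (fun x _ => listD φ x)) :
    ∃ ψ : List X → M, Negligible b 0 n (fun _ y => ψ y) ∧
      Negligible b (n + 1) 0 (fun x _ => φ x - listD ψ x) ∧ ψ [] = 0 := by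
  obtain ⟨θ, hθ0, hθ⟩ := exists_sub_listTot_negligible_of_zero_left (n := n)
    (f := fun x y => φ (x ++ y)) hcol
    (hφ.congr fun x y hx _ => by rw [List.length_eq_zero_iff.1 hx, List.nil_append])
    (fun p q hpq => (hdφ.append hpq).congr fun x y _ _ => listTot_append φ x y)
  -- For `y` empty, the total coboundary of `θ` is `listD ψ`, so `φ - listD ψ` is coarse; but `ψ`
  -- need not be boundedly supported.
  set ψ : List X → M := fun x => θ x [] with hψ
  have h1 : Negligible b (n + 1) 0 (fun x _ => φ x - listD ψ x) :=
    (hθ (n + 1) 0 rfl).congr fun x y _ hy => by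
      rw [List.length_eq_zero_iff.1 hy, List.append_nil]
      simp [listTot, listDx, listDy, hψ]
  -- This cocycle vanishes for `y` empty, so it is the total coboundary of some `ζ`. For `x` empty,
  -- where `θ` is zero, that says `ψ - listD (ζ [])` is boundedly supported.
  obtain ⟨ζ, hζ⟩ := exists_sub_listTot_negligible_of_zero_right (b := b) (n := n)
    (f := fun x y => ψ (x ++ y) - θ x y)
    (Negligible.zero.congr fun x y _ hy => by
      rw [List.length_eq_zero_iff.1 hy, List.append_nil]
      simp [hψ])
    (fun p q hpq => ((hθ p q hpq).sub (h1.append hpq)).congr fun x y _ _ => by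
      rw [listTot_sub, listTot_append]
      abel)
  refine ⟨fun x => ψ x - listD (ζ []) x, (hζ 0 n (zero_add n)).congr fun x y hx _ => ?_,
    h1.congr fun x y _ _ => by rw [listD_sub, listD_listD, sub_zero], ?_⟩
  · rw [List.length_eq_zero_iff.1 hx]
    simp [listTot, listDx, listDy, hθ0]
  · simp [hψ, hθ0]

end Negligible

/-! ### Homotopy invariance with a locally varying mesh -/

section Contraction

/-- The largest multiple of `2⁻ᵐ` that is at most `j / 2ᵏ`, for `m ≤ k`. -/
noncomputable def dyadicFloor (k m j : ℕ) : ℝ := ((j / 2 ^ (k - m) : ℕ) : ℝ) / 2 ^ m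

theorem dyadicFloor_zero (k m : ℕ) : dyadicFloor k m 0 = 0 := by simp [dyadicFloor]

theorem dyadicFloor_two_pow {k m : ℕ} (h : m ≤ k) : dyadicFloor k m (2 ^ k) = 1 := by
  simp [dyadicFloor, Nat.pow_div (Nat.sub_le k m) two_pos, Nat.sub_sub_self h]

theorem dyadicFloor_succ_two_mul {k m : ℕ} (h : m ≤ k) (j : ℕ) :
    dyadicFloor (k + 1) m (2 * j) = dyadicFloor k m j := by
  rw [dyadicFloor, dyadicFloor, Nat.succ_sub h, pow_succ', ← Nat.div_div_eq_div_mul,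
    Nat.mul_div_cancel_left _ two_pos]

theorem dyadicFloor_succ_two_mul_add_one {k m : ℕ} (h : m ≤ k) (j : ℕ) :
    dyadicFloor (k + 1) m (2 * j + 1) = dyadicFloor k m j := by
  rw [dyadicFloor, dyadicFloor, Nat.succ_sub h, pow_succ', ← Nat.div_div_eq_div_mul]
  congr 3
  omega

theorem dyadicFloor_mem {k m : ℕ} (h : m ≤ k) (j : ℕ) :
    dyadicFloor k m j ≤ (j : ℝ) / 2 ^ k ∧ (j : ℝ) / 2 ^ k < dyadicFloor k m j + (1 / 2) ^ m := by
  have hk : (2 : ℝ) ^ k = 2 ^ (k - m) * 2 ^ m := by rw [← pow_add, Nat.sub_add_cancel h]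
  have h1 : ((j / 2 ^ (k - m) : ℕ) : ℝ) ≤ (j : ℝ) / 2 ^ (k - m) := by
    simpa using Nat.cast_div_le (α := ℝ) (m := j) (n := 2 ^ (k - m))
  have h2 : (j : ℝ) / 2 ^ (k - m) < ((j / 2 ^ (k - m) : ℕ) : ℝ) + 1 := by
    rw [div_lt_iff₀ (by positivity)]
    exact_mod_cast Nat.lt_mul_of_div_lt (Nat.lt_succ_self (j / 2 ^ (k - m))) (by positivity)
  rw [hk, ← div_div, dyadicFloor, one_div, inv_pow, ← one_div, ← add_div]
  exact ⟨by gcongr, by gcongr⟩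

theorem abs_dyadicFloor_sub_le {k m : ℕ} (h : m ≤ k) (j : ℕ) :
    |dyadicFloor k m j - (j : ℝ) / 2 ^ k| ≤ (1 / 2) ^ m := by
  obtain ⟨h1, h2⟩ := dyadicFloor_mem h j
  rw [abs_le]
  constructor <;> linarith [show (0 : ℝ) < (1 / 2) ^ m by positivity]

theorem abs_dyadicFloor_succ_sub_le {k m : ℕ} (h : m ≤ k) (j : ℕ) :
    |dyadicFloor k m (j + 1) - (j : ℝ) / 2 ^ k| ≤ (1 / 2) ^ m := by
  obtain ⟨h1, h2⟩ := dyadicFloor_mem h j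
  obtain ⟨h3, -⟩ := dyadicFloor_mem h (j + 1)
  have h4 : (1 / 2 : ℝ) ^ k ≤ (1 / 2) ^ m :=
    pow_le_pow_of_le_one (by norm_num) (by norm_num) h
  have h5 : dyadicFloor k m j ≤ dyadicFloor k m (j + 1) := by
    unfold dyadicFloor
    gcongr
    omega
  have h6 : ((j + 1 : ℕ) : ℝ) / 2 ^ k = (j : ℝ) / 2 ^ k + (1 / 2) ^ k := by
    rw [Nat.cast_succ, add_div, one_div_pow]
  rw [abs_le]
  constructor <;> linarith

variable {X Y M : Type*} [AddCommGroup M]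

/-- A mesh function adapted to a local condition that is monotone in the scale. -/
theorem exists_mesh [MetricSpace Y] {F : Y → ℝ → Prop} (hex : ∀ z, ∃ δ > 0, F z δ)
    (hF : ∀ y z δ δ', F y δ → δ' + dist z y ≤ δ → F z δ') :
    ∃ m : Y → ℕ, ∀ z, ∃ δ > 0, F z δ ∧
      ∃ ε > 0, ε ≤ δ ∧ ∀ y, dist y z < ε → (1 / 2 : ℝ) ^ m y < δ := by
  -- With `m` least, points `y` within `2⁻ᵐ⁽ᶻ⁾` of `z` satisfy `m y ≥ m z - 1`, so their mesh is at
  -- most `2 · 2⁻ᵐ⁽ᶻ⁾`, strictly below `δ = 4 · 2⁻ᵐ⁽ᶻ⁾`.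
  have hex' : ∀ z, ∃ m : ℕ, F z (4 * (1 / 2) ^ m) := fun z => by
    obtain ⟨δ, hδ, h⟩ := hex z
    obtain ⟨n, hn⟩ := exists_pow_lt_of_lt_one (show 0 < δ / 4 by positivity)
      (show (1 / 2 : ℝ) < 1 by norm_num)
    exact ⟨n, hF z z δ _ h (by rw [dist_self]; linarith)⟩
  classical
  refine ⟨fun z => Nat.find (hex' z), fun z => ⟨_, by positivity, Nat.find_spec (hex' z),
    (1 / 2) ^ Nat.find (hex' z), by positivity, ?_, fun y hy => ?_⟩⟩
  · linarith [show (0 : ℝ) < (1 / 2) ^ Nat.find (hex' z) by positivity]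
  have hle : Nat.find (hex' z) ≤ Nat.find (hex' y) + 1 := by
    rcases le_total (Nat.find (hex' z)) (Nat.find (hex' y)) with h | h
    · omega
    refine Nat.find_min' _ (hF y z _ _ (Nat.find_spec (hex' y)) ?_)
    have : (1 / 2 : ℝ) ^ Nat.find (hex' z) ≤ (1 / 2) ^ Nat.find (hex' y) :=
      pow_le_pow_of_le_one (by norm_num) (by norm_num) h
    rw [dist_comm, pow_succ]
    linarith [show (0 : ℝ) < (1 / 2) ^ Nat.find (hex' y) by positivity]
  have h1 : (1 / 2 : ℝ) ^ (Nat.find (hex' y) + 1) ≤ (1 / 2) ^ Nat.find (hex' z) :=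
    pow_le_pow_of_le_one (by norm_num) (by norm_num) hle
  rw [pow_succ] at h1
  linarith [show (0 : ℝ) < (1 / 2) ^ Nat.find (hex' z) by positivity]

/-- The prism operator of a homotopy `H` on the lists of points of mesh at most `k`, in which the
time interval above a point `y` is divided into `2 ^ m y` parts. -/
noncomputable def sweep (H : Y → ℝ → X) (m : Y → ℕ) (k : ℕ) (g : List X → M) (l : List Y) : M :=
  ∑ j ∈ Finset.range (2 ^ k), listPrism (fun y => H y (dyadicFloor k (m y) j))
    (fun y => H y (dyadicFloor k (m y) (j + 1))) g l

/-- Each time step splits in two. No vertex moves in the first half, so its prism vanishes because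
stationary vertices are omitted; the second half is the old prism. -/
theorem sweep_succ {H : Y → ℝ → X} {m : Y → ℕ} {k : ℕ} {g : List X → M} {l : List Y}
    (h : ∀ y ∈ l, m y ≤ k) : sweep H m (k + 1) g l = sweep H m k g l := by
  have h2 : ∀ (n : ℕ) (f : ℕ → M), ∑ j ∈ Finset.range (2 * n), f j =
      ∑ j ∈ Finset.range n, (f (2 * j) + f (2 * j + 1)) := fun n f => by
    induction n with
    | zero => simp
    | succ n ih => rw [mul_add, Finset.sum_range_succ, Finset.sum_range_succ, ih,
        Finset.sum_range_succ, add_assoc]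
  rw [sweep, pow_succ', h2, sweep]
  refine Finset.sum_congr rfl fun j _ => ?_
  rw [listPrism_self, zero_add]
  · refine listPrism_congr (fun y hy => ?_) (fun y hy => ?_)
    · rw [dyadicFloor_succ_two_mul_add_one (h y hy)]
    · rw [← dyadicFloor_succ_two_mul (h y hy) (j + 1), mul_add, mul_one]
  · intro y hy
    rw [dyadicFloor_succ_two_mul_add_one (h y hy), dyadicFloor_succ_two_mul (h y hy)]

theorem sweep_eq_of_le {H : Y → ℝ → X} {m : Y → ℕ} {k k' : ℕ} {g : List X → M} {l : List Y}
    (h : ∀ y ∈ l, m y ≤ k) (hk : k ≤ k') : sweep H m k' g l = sweep H m k g l := by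
  induction k', hk using Nat.le_induction with
  | base => rfl
  | succ k' hk ih => rw [sweep_succ fun y hy => (h y hy).trans hk, ih]

theorem listD_sweep {H : Y → ℝ → X} {m : Y → ℕ} {k : ℕ} {g : List X → M} {l : List Y}
    (h : ∀ y ∈ l, m y ≤ k) : listD (sweep H m k g) l + sweep H m k (listD g) l =
      g (l.map fun y => H y 1) - g (l.map fun y => H y 0) := by
  have h1 : listD (sweep H m k g) l = _ := listD_sum _ _ l
  rw [h1, sweep, ← Finset.sum_add_distrib]
  simp only [listD_listPrism]
  rw [Finset.sum_range_sub (fun j => g (l.map fun y => H y (dyadicFloor k (m y) j)))]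
  congr 2
  · exact List.map_congr_left fun y hy => by rw [dyadicFloor_two_pow (h y hy)]
  · simp only [dyadicFloor_zero]

/-- Homotopy invariance: a cocycle near the track of a contraction is a coboundary. -/
theorem exists_listD_vanishesNear_of_homotopy [MetricSpace X] [MetricSpace Y] {H : Y → ℝ → X}
    (hH : Continuous (Function.uncurry H)) {c : X} (hc : ∀ y, H y 1 = c) {q : ℕ} {g : List X → M}
    (hg : ∀ y, ∀ t ∈ Icc (0 : ℝ) 1, VanishesNear (q + 1) (H y t) (listD g)) :
    ∃ ψ : List Y → M, ∀ z, VanishesNear q z fun l => g (l.map fun y => H y 0) - listD ψ l := by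
  -- The Lebesgue number of `{z} × [0, 1]` supplies `δ`. It depends on `z`, so the subdivision must
  -- vary from vertex to vertex.
  let F : Y → ℝ → Prop := fun z δ => ∀ t ∈ Icc (0 : ℝ) 1, ∃ U : Set X,
    (∀ l : List X, l.length = q + 1 → (∀ x ∈ l, x ∈ U) → listD g l = 0) ∧
      ∀ y s, dist y z < δ → |s - t| < δ → H y s ∈ U
  have hex : ∀ z, ∃ δ > 0, F z δ := by
    intro z
    choose! ε hε hv using hg
    obtain ⟨δ, hδ, h⟩ := lebesgue_number_lemma_of_metric
      (s := ({z} : Set Y) ×ˢ Icc (0 : ℝ) 1) (ι := Icc (0 : ℝ) 1)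
      (c := fun t => Function.uncurry H ⁻¹' ball (H z t) (ε z t))
      (isCompact_singleton.prod isCompact_Icc) (fun t => isOpen_ball.preimage hH) (by
        rintro ⟨z', t⟩ ⟨rfl, ht⟩
        exact mem_iUnion.2 ⟨⟨t, ht⟩, mem_ball_self (hε _ _ ht)⟩)
    refine ⟨δ, hδ, fun t ht => ?_⟩
    obtain ⟨i, hi⟩ := h (z, t) ⟨rfl, ht⟩
    refine ⟨ball (H z i) (ε z i), fun l hl hx => hv z i i.2 l hl hx, fun y s hy hs => ?_⟩
    exact hi (a := (y, s)) (by simpa [Prod.dist_eq, Real.dist_eq] using ⟨hy, hs⟩)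
  obtain ⟨m, hm⟩ := exists_mesh hex fun y z δ δ' hy hd t ht => by
    obtain ⟨U, hU, h⟩ := hy t ht
    refine ⟨U, hU, fun y' s hy' hs => h y' s ?_ (hs.trans_le ?_)⟩
    · linarith [dist_triangle y' z y]
    · linarith [dist_nonneg (x := z) (y := y)]
  have hK : ∃ K : List Y → ℕ, ∀ l, ∀ y ∈ l, m y ≤ K l :=
    ⟨fun l => (l.map m).sum, fun l y hy => List.single_le_sum (by simp) _ (List.mem_map_of_mem hy)⟩
  obtain ⟨K, hK⟩ := hK
  -- The sweep compares time `0` with time `1`, where all vertices sit at `c`; the first term is the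
  -- cone with apex `c` that bounds what remains.
  refine ⟨fun l => g (c :: l.map fun _ => c) - sweep H m (K l) g l, fun z => ?_⟩
  obtain ⟨δ, hδ, hF, ε, hε, hεδ, hy⟩ := hm z
  refine ⟨ε, hε, fun l hl hw => ?_⟩
  have hv : sweep H m (K l) (listD g) l = 0 := by
    refine Finset.sum_eq_zero fun j hj => ?_
    have hj' : (j : ℝ) / 2 ^ K l ∈ Icc (0 : ℝ) 1 := by
      refine ⟨by positivity, (div_le_one (by positivity)).2 ?_⟩
      exact_mod_cast (Finset.mem_range.1 hj).le
    obtain ⟨U, hU, hHU⟩ := hF _ hj'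
    refine listPrism_eq_zero (U := U) (fun m hm => hU m (by rw [hm, hl])) (fun y hyl => ?_)
      (fun y hyl => ?_)
    · exact hHU _ _ ((hw y hyl).trans_le hεδ)
        ((abs_dyadicFloor_sub_le (hK l y hyl) j).trans_lt (hy y (hw y hyl)))
    · exact hHU _ _ ((hw y hyl).trans_le hεδ)
        ((abs_dyadicFloor_succ_sub_le (hK l y hyl) j).trans_lt (hy y (hw y hyl)))
  -- A face `l'` has its own level `K l'`, but the sweep does not depend on the level once it
  -- dominates the mesh.
  have hs : listD (fun l => sweep H m (K l) g l) l = listD (sweep H m (K l) g) l := by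
    refine listD_congr fun l' hl' _ => ?_
    rcases le_total (K l') (K l) with h | h
    · exact (sweep_eq_of_le (hK l') h).symm
    · exact sweep_eq_of_le (fun y hy => hK l y (hl'.subset hy)) h
  have h1 := listD_sweep (H := H) (g := g) (hK l)
  have h2 : listD g (c :: l.map fun _ => c) = 0 := by
    obtain ⟨η, hη, h⟩ := hg z 1 (by simp)
    refine h _ (by simp [hl]) ?_
    simp [hc, hη]
  have h3 := listD_map (fun l => g (c :: l)) (fun _ : Y => c) l
  rw [listD_cons, sub_eq_zero] at h2
  simp only [hc, hv, add_zero] at h1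
  beta_reduce
  rw [listD_sub, hs, h1, h3, ← h2]
  abel

end Contraction

/-! ### Column exactness from contractibility at infinity -/

section Columns

variable {X M : Type*} [MetricSpace X] [AddCommGroup M]

/-- A cocycle near `A` is a coboundary near an open subset that is contractible in `A`. -/
theorem exists_listD_vanishesNear_of_nullhomotopic {A B : Set X} (hB : IsOpen B)
    (hne : B.Nonempty) (hBA : B ⊆ A) (h : (ContinuousMap.inclusion hBA).Nullhomotopic) {q : ℕ}
    {g : List X → M} (hg : ∀ a ∈ A, VanishesNear (q + 1) a (listD g)) :
    ∃ ψ : List X → M, ∀ z ∈ B, VanishesNear q z fun l => g l - listD ψ l := by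
  obtain ⟨c, ⟨F⟩⟩ := h
  obtain ⟨ψ, hψ⟩ := exists_listD_vanishesNear_of_homotopy (Y := B) (c := (c : X)) (q := q) (g := g)
    (H := fun y t => (F (projIcc 0 1 zero_le_one t, y) : X))
    (by
      have : Continuous (projIcc (0 : ℝ) 1 zero_le_one) := continuous_projIcc
      unfold Function.uncurry
      fun_prop)
    (fun y => by simp) (fun y t _ => hg _ (Subtype.coe_prop _))
  obtain ⟨x0, hx0⟩ := hne
  classical
  -- An arbitrary retraction suffices: `B` is open, so lists close to a point of `B` lie in `B`.
  let π : X → B := fun x => if h : x ∈ B then ⟨x, h⟩ else ⟨x0, hx0⟩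
  have hπ : ∀ x ∈ B, (π x : X) = x := fun x hx => by simp [π, hx]
  refine ⟨fun l => ψ (l.map π), fun z hz => ?_⟩
  obtain ⟨ε, hε, h⟩ := hψ ⟨z, hz⟩
  obtain ⟨δ, hδ, hb⟩ := Metric.isOpen_iff.1 hB z hz
  refine ⟨min ε δ, lt_min hε hδ, fun l hl hw => ?_⟩
  have hl' : ∀ w ∈ l, w ∈ B := fun w hw' => hb ((hw w hw').trans_le (min_le_right _ _))
  have h1 := h (l.map π) (by simpa using hl) (by
    simp only [List.mem_map, forall_exists_index, and_imp, forall_apply_eq_imp_iff₂]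
    intro w hw'
    rw [Subtype.dist_eq, hπ w (hl' w hw')]
    exact (hw w hw').trans_le (min_le_left _ _))
  have h2 : ((l.map π).map fun y : B => (F (projIcc 0 1 zero_le_one (0 : ℝ), y) : X)) = l := by
    rw [List.map_map]
    refine (List.map_congr_left fun w hw' => ?_).trans (List.map_id l)
    simp only [Function.comp_apply, projIcc_left]
    exact (congrArg Subtype.val (F.apply_zero (π w))).trans (hπ w (hl' w hw'))
  beta_reduce at h1 ⊢
  rwa [h2, ← listD_map] at h1

/-- Exactness in the second variable for spaces that are uniformly contractible at infinity. -/
theorem UniformlyContractibleAtInfinity.exists_sub_listDy_negligible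
    (hX : UniformlyContractibleAtInfinity X) :
    ∃ b : X, ∀ (p q : ℕ) (f : List X → List X → M), Negligible b (p + 1) (q + 1) (listDy f) →
      ∃ ψ : List X → List X → M, Negligible b (p + 1) q (fun x y => f x y - listDy ψ x y) := by
  obtain ⟨ρ, μ, b, hρ, hμ, h⟩ := hX
  refine ⟨b, fun p q f hf => ?_⟩
  let P : X → List X → ℕ → (List X → M) → Prop := fun x0 x k ψ =>
    ∀ z ∈ ball x0 k, VanishesNear q z fun y => f x y - listD ψ y
  have hP : ∀ k : ℕ, ∃ C : ℝ, ∀ z, C ≤ dist z b → ∀ x0 x, (x0 :: x).length = p + 1 →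
      (∀ w ∈ x0 :: x, dist w z < k) → ∃ ψ, P x0 (x0 :: x) k ψ := by
    intro k
    -- For `a ∈ A`, an entry of the list is within `k` of `z`, `z` within `k` of `x0`, and `x0`
    -- within `ρ (2 * k)` of `a`.
    obtain ⟨C, hC⟩ := hf (2 * k + ρ (2 * k))
    refine ⟨max (C + k + ρ (2 * k)) (μ (2 * k) + 2 * k), fun z hz x0 x hx hr => ?_⟩
    have hx0 : dist x0 z < k := hr x0 (by simp)
    have hk : (0 : ℝ) < k := dist_nonneg.trans_lt hx0
    have htri := dist_triangle z x0 b
    rw [dist_comm z x0] at htri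
    have hd : diam (ball x0 (k : ℝ)) ≤ 2 * k := diam_ball hk.le
    lift diam (ball x0 (k : ℝ)) to ℝ≥0 using diam_nonneg with r hr'
    have hr2 : r ≤ 2 * k := by exact_mod_cast hd
    obtain ⟨A, hBA, hA, hAd, hnull⟩ := h r (ball x0 k) ⟨x0, mem_ball_self hk⟩ isBounded_ball
      hr'.symm (by
        refine (le_infDist ⟨x0, mem_ball_self hk⟩).2 fun y hy => ?_
        have h1 : (μ r : ℝ) ≤ μ (2 * k) := hμ hr2
        have h2 := dist_triangle x0 y b
        have h3 := mem_ball'.1 hy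
        have h4 := (le_max_right _ _).trans hz
        rw [dist_comm b y]
        linarith)
    refine exists_listD_vanishesNear_of_nullhomotopic isOpen_ball ⟨x0, mem_ball_self hk⟩ hBA hnull
      fun a ha => ?_
    have h1 : dist x0 a ≤ ρ (2 * k) := by
      have h2 : (ρ r : ℝ) ≤ ρ (2 * k) := hρ hr2
      exact (dist_le_diam_of_mem hA (hBA (mem_ball_self hk)) ha).trans (hAd.trans h2)
    refine hC a ?_ _ hx fun w hw => ?_
    · have h2 := dist_triangle x0 a b
      have h4 := (le_max_left _ _).trans hz
      linarith
    · have h2 := dist_triangle4 w z x0 a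
      have h3 := hr w hw
      rw [dist_comm z x0] at h2
      linarith
  -- One `ψ` must serve every radius `r`. A primitive on the largest solvable ball also works on the
  -- smaller ones; the cap `dist x0 b` ensures that a largest exists.
  have hmax : ∀ x0 x, ∃ ψ, ∀ k : ℕ, (k : ℝ) ≤ dist x0 b → (∃ ψ', P x0 (x0 :: x) k ψ') →
      P x0 (x0 :: x) k ψ := by
    intro x0 x
    classical
    by_cases hne : ∃ k : ℕ, (k : ℝ) ≤ dist x0 b ∧ ∃ ψ', P x0 (x0 :: x) k ψ'
    · obtain ⟨k0, hk0, hψ0⟩ := hne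
      have hspec := Nat.findGreatest_spec (P := fun k => ∃ ψ', P x0 (x0 :: x) k ψ')
        (Nat.le_floor hk0) hψ0
      obtain ⟨ψ, hψ⟩ := hspec
      refine ⟨ψ, fun k hk hk' z hz => hψ z (ball_subset_ball ?_ hz)⟩
      exact_mod_cast Nat.le_findGreatest (Nat.le_floor hk) hk'
    · push Not at hne
      exact ⟨fun _ => 0, fun k hk ⟨ψ', hψ'⟩ => (hne k hk ψ' hψ').elim⟩
  choose ψ hψ using hmax
  refine ⟨fun x => match x with
    | [] => fun _ => 0
    | x0 :: x => ψ x0 x, fun r => ?_⟩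
  obtain ⟨k, hk⟩ := exists_nat_ge r
  obtain ⟨C, hC⟩ := hP k
  -- `2 * k` puts `x0` at distance at least `k` from `b`, so the cap allows `k`.
  refine ⟨max C (2 * k), fun z hz x hx hr => ?_⟩
  rcases x with - | ⟨x0, x⟩
  · simp at hx
  have hr' : ∀ w ∈ x0 :: x, dist w z < k := fun w hw => (hr w hw).trans_le hk
  have hx0 := hr' x0 (by simp)
  refine hψ x0 x k ?_ (hC z ((le_max_left _ _).trans hz) x0 x hx hr') z (mem_ball'.2 hx0)
  have h1 := dist_triangle z x0 b
  have h2 := (le_max_right _ _).trans hz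
  rw [dist_comm z x0] at h1
  linarith

end Columns

/-! ### Elementwise criteria for maps on homology -/

section Homology

variable {S : Type*} [Ring S] {ι : Type*} {c : ComplexShape ι}
  {K L : HomologicalComplex (ModuleCat S) c}

/-- The module `E` of all pairs of an element and a solution surjects onto `A`, so pointwise
solvability suffices and no linear choice is needed. -/
theorem mono_homologyMap_of_forall_exists (φ : K ⟶ L) {i j k : ι} (hi : c.prev j = i)
    (hk : c.next j = k)
    (h : ∀ x : K.X j, K.d j k x = 0 → ∀ y : L.X i, φ.f j x = L.d i j y →
      ∃ x' : K.X i, x = K.d i j x') : Mono (HomologicalComplex.homologyMap φ j) := by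
  rw [HomologicalComplex.mono_homologyMap_iff_up_to_refinements φ i j k hi hk]
  intro A x hx y hxy
  let E := LinearMap.eqLocus (x.hom ∘ₗ LinearMap.fst S A (K.X i))
    ((K.d i j).hom ∘ₗ LinearMap.snd S A (K.X i))
  refine ⟨ModuleCat.of S E, ModuleCat.ofHom (LinearMap.fst S A (K.X i) ∘ₗ E.subtype),
    (ModuleCat.epi_iff_surjective _).2 fun a => ?_,
    ModuleCat.ofHom (LinearMap.snd S A (K.X i) ∘ₗ E.subtype), ?_⟩
  · obtain ⟨x', hx'⟩ := h (x a) (ConcreteCategory.congr_hom hx a) (y a)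
      (ConcreteCategory.congr_hom hxy a)
    exact ⟨⟨(a, x'), hx'⟩, rfl⟩
  · ext e
    exact e.2

theorem epi_homologyMap_of_forall_exists (φ : K ⟶ L) {i j k : ι} (hi : c.prev j = i)
    (hk : c.next j = k)
    (h : ∀ y : L.X j, L.d j k y = 0 → ∃ x : K.X j, K.d j k x = 0 ∧
      ∃ y' : L.X i, y = φ.f j x + L.d i j y') : Epi (HomologicalComplex.homologyMap φ j) := by
  rw [HomologicalComplex.epi_homologyMap_iff_up_to_refinements φ i j k hi hk]
  intro A y hy
  let pA := LinearMap.fst S A (K.X j × L.X i)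
  let pK := LinearMap.fst S (K.X j) (L.X i) ∘ₗ LinearMap.snd S A (K.X j × L.X i)
  let pL := LinearMap.snd S (K.X j) (L.X i) ∘ₗ LinearMap.snd S A (K.X j × L.X i)
  let E := LinearMap.eqLocus (y.hom ∘ₗ pA) ((φ.f j).hom ∘ₗ pK + (L.d i j).hom ∘ₗ pL) ⊓
    LinearMap.ker ((K.d j k).hom ∘ₗ pK)
  refine ⟨ModuleCat.of S E, ModuleCat.ofHom (pA ∘ₗ E.subtype),
    (ModuleCat.epi_iff_surjective _).2 fun a => ?_, ModuleCat.ofHom (pK ∘ₗ E.subtype), ?_,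
    ModuleCat.ofHom (pL ∘ₗ E.subtype), ?_⟩
  · obtain ⟨x, hx, y', hy'⟩ := h (y a) (ConcreteCategory.congr_hom hy a)
    exact ⟨⟨(a, x, y'), hy', hx⟩, rfl⟩
  · ext e
    exact e.2.2
  · ext e
    exact e.2.1

end Homology

/-! ### Translation between cochains and functions of lists -/

section Cochains

variable {X : Type u} {R : Type v}

theorem exists_list_extension [Zero R] {n : ℕ} (φ : Cochain X R n) :
    ∃ f : List X → R, ∀ σ, f (List.ofFn σ) = φ σ := by
  classical
  refine ⟨fun l => if h : ∃ σ : Fin (n + 1) → X, List.ofFn σ = l then φ h.choose else 0,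
    fun σ => ?_⟩
  have h : ∃ τ : Fin (n + 1) → X, List.ofFn τ = List.ofFn σ := ⟨σ, rfl⟩
  beta_reduce
  rw [dif_pos h, List.ofFn_injective h.choose_spec]

theorem forall_list_length_eq {n : ℕ} {P : List X → Prop} :
    (∀ l : List X, l.length = n → P l) ↔ ∀ σ : Fin n → X, P (List.ofFn σ) := by
  refine ⟨fun h σ => h _ (List.length_ofFn), ?_⟩
  rintro h l rfl
  simpa using h l.get

theorem listD_ofFn {M : Type*} [AddCommGroup M] {n : ℕ} (f : List X → M) (σ : Fin (n + 1) → X) :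
    listD f (List.ofFn σ) =
      ∑ i : Fin (n + 1), (-1 : ℤ) ^ (i : ℕ) • f (List.ofFn fun j => σ (i.succAbove j)) := by
  induction n generalizing f with
  | zero => simp [listD_cons]
  | succ n ih =>
    rw [List.ofFn_succ, listD_cons, ih, Fin.sum_univ_succ (n := n + 1), sub_eq_add_neg,
      ← Finset.sum_neg_distrib]
    congr 1
    · simp
    · refine Finset.sum_congr rfl fun i _ => ?_
      rw [List.ofFn_succ (f := fun j => σ (i.succ.succAbove j))]
      simp [pow_succ]

theorem coboundary_ofFn [Ring R] {n : ℕ} {φ : Cochain X R n} {f : List X → R}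
    (hf : ∀ σ, f (List.ofFn σ) = φ σ) (σ : Fin (n + 2) → X) :
    listD f (List.ofFn σ) = coboundary X R n φ σ := by
  rw [listD_ofFn]
  simp only [hf]
  rfl

variable [MetricSpace X] [Ring R]

theorem mem_coarseCochains_iff (b : X) {n : ℕ} {φ : Cochain X R n} {f : List X → R}
    (hf : ∀ σ, f (List.ofFn σ) = φ σ) :
    φ ∈ coarseCochains X R n ↔ Negligible b (n + 1) 0 (fun x _ => f x) := by
  have h0 : ∀ z x, VanishesNear 0 z (fun _ : List X => f x) ↔ f x = 0 := fun z x =>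
    ⟨fun ⟨_, _, h⟩ => h [] rfl (by simp), fun h => ⟨1, one_pos, fun _ _ _ => h⟩⟩
  change (∀ r : ℝ, _) ↔ ∀ r : ℝ, _
  refine forall_congr' fun r => ?_
  simp only [h0, forall_list_length_eq, hf, List.forall_mem_ofFn_iff]
  constructor
  · intro h
    obtain ⟨C, hC⟩ := h.subset_closedBall (Function.const _ b)
    refine ⟨C + r + 1, fun z hz σ hσ => by_contra fun hne => ?_⟩
    have h1 := (dist_le_pi_dist _ _ 0).trans
      (hC ⟨hne, (mem_thickening_diagonal X).2 ⟨z, hσ⟩⟩)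
    have h2 := dist_triangle z (σ 0) b
    have h3 := hσ 0
    rw [dist_comm] at h3
    simp only [Function.const_apply] at h1
    linarith
  · rintro ⟨C, hC⟩
    refine (isBounded_closedBall (x := Function.const (Fin (n + 1)) b) (r := r + C)).subset ?_
    rintro σ ⟨hσ, hr⟩
    obtain ⟨z, hz⟩ := (mem_thickening_diagonal X).1 hr
    have hzC : dist z b < C := lt_of_not_ge fun h => hσ (hC z h σ hz)
    have h1 : ∀ i, dist (σ i) b ≤ r + C := fun i => by
      linarith [dist_triangle (σ i) z b, hz i]
    exact (dist_pi_le_iff (dist_nonneg.trans (h1 0))).2 h1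

/-- With `x` empty the radius `r` plays no role, and vanishing near `z` says that `z` is outside
`diagSupport φ`. -/
theorem mem_boundedCochains_iff (b : X) {n : ℕ} {φ : Cochain X R n} {f : List X → R}
    (hf : ∀ σ, f (List.ofFn σ) = φ σ) :
    φ ∈ boundedCochains X R n ↔ Negligible b 0 (n + 1) (fun _ y => f y) := by
  have h0 : ∀ z, VanishesNear (n + 1) z f ↔ z ∉ diagSupport φ := fun z => by
    simp only [VanishesNear, forall_list_length_eq, hf, List.forall_mem_ofFn_iff, diagSupport,
      mem_ofPred_eq, Metric.mem_closure_iff, Function.mem_support]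
    push Not
    refine exists_congr fun ε => and_congr_right fun hε => forall_congr' fun σ => ?_
    have h : dist (Function.const (Fin (n + 1)) z) σ < ε ↔ ∀ i, dist (σ i) z < ε := by
      rw [dist_comm, dist_pi_lt_iff hε]
      rfl
    rw [← not_lt, h]
    tauto
  have h1 : Negligible b 0 (n + 1) (fun _ y => f y) ↔
      ∃ C : ℝ, ∀ z, C ≤ dist z b → VanishesNear (n + 1) z f :=
    ⟨fun h => (h 0).imp fun C hC z hz => hC z hz [] rfl (by simp),
      fun ⟨C, hC⟩ r => ⟨C, fun z hz _ _ _ => hC z hz⟩⟩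
  rw [h1]
  simp only [h0]
  constructor
  · intro h
    obtain ⟨C, hC⟩ := (show IsBounded (diagSupport φ) from h).subset_closedBall b
    refine ⟨C + 1, fun z hz hzφ => ?_⟩
    have := mem_closedBall.1 (hC hzφ)
    linarith
  · rintro ⟨C, hC⟩
    refine (isBounded_ball (x := b) (r := C)).subset fun z hz => ?_
    exact lt_of_not_ge fun h => hC z h hz

/-- In positive degrees, a boundedly supported cochain with coarse coboundary differs from a coarse
cochain by the coboundary of a boundedly supported cochain. -/
theorem UniformlyContractibleAtInfinity.exists_sub_coboundary_mem_coarseCochains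
    (hX : UniformlyContractibleAtInfinity X) {n : ℕ} {φ : Cochain X R (n + 1)}
    (hφ : φ ∈ boundedCochains X R (n + 1))
    (hdφ : coboundary X R (n + 1) φ ∈ coarseCochains X R (n + 2)) :
    ∃ ψ ∈ boundedCochains X R n, φ - coboundary X R n ψ ∈ coarseCochains X R (n + 1) := by
  obtain ⟨b, hb⟩ := hX.exists_sub_listDy_negligible (M := R)
  obtain ⟨f, hf⟩ := exists_list_extension φ
  obtain ⟨g, hg1, hg2, -⟩ := exists_sub_listD_negligible hb
    ((mem_boundedCochains_iff b hf).1 hφ) ((mem_coarseCochains_iff b (coboundary_ofFn hf)).1 hdφ)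
  refine ⟨fun σ => g (List.ofFn σ), (mem_boundedCochains_iff b fun _ => rfl).2 hg1,
    (mem_coarseCochains_iff b fun σ => ?_).2 hg2⟩
  rw [Pi.sub_apply, hf, coboundary_ofFn fun _ => rfl]

/-- A boundedly supported cochain of degree zero with coarse coboundary is coarse. -/
theorem UniformlyContractibleAtInfinity.mem_coarseCochains_zero
    (hX : UniformlyContractibleAtInfinity X) {φ : Cochain X R 0}
    (hφ : φ ∈ boundedCochains X R 0) (hdφ : coboundary X R 0 φ ∈ coarseCochains X R 1) :
    φ ∈ coarseCochains X R 0 := by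
  obtain ⟨b, hb⟩ := hX.exists_sub_listDy_negligible (M := R)
  obtain ⟨f, hf⟩ := exists_list_extension φ
  obtain ⟨g, -, hg2, hg3⟩ := exists_sub_listD_negligible hb
    ((mem_boundedCochains_iff b hf).1 hφ) ((mem_coarseCochains_iff b (coboundary_ofFn hf)).1 hdφ)
  -- A one-point list has only the empty face, so `listD g [x] = g [] = 0` and `φ` needs no
  -- correction.
  refine (mem_coarseCochains_iff b hf).2 (hg2.congr fun x _ hx _ => ?_)
  obtain ⟨x, rfl⟩ := List.length_eq_one_iff.1 hx
  simp [listD_cons, hg3]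

omit [MetricSpace X] in
theorem subcomplex_d_apply (S : ∀ n, Submodule R (Cochain X R n))
    (hS : ∀ n, ∀ φ ∈ S n, coboundary X R n φ ∈ S (n + 1)) (n : ℕ) (x : S n) :
    (subcomplex X R S hS).d n (n + 1) x = (coboundary X R n).restrict (hS n) x := by
  simp only [subcomplex, CochainComplex.of_d]
  rfl

end Cochains

end CoarseCohomology

/-! ### The isomorphism -/

open CoarseCohomology in
theorem mainTheorem1 (X : Type u) [MetricSpace X] (R : Type v) [Ring R]
    (hX : CoarseCohomology.UniformlyContractibleAtInfinity X) (n : ℕ) :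
    CategoryTheory.IsIso
      (HomologicalComplex.homologyMap (CoarseCohomology.coarseInclusion X R) n) := by
  have dC (n : ℕ) (x : coarseCochains X R n) : (coarseComplex X R).d n (n + 1) x =
      (coboundary X R n).restrict (coboundary_mem_coarseCochains X R n) x :=
    subcomplex_d_apply _ _ n x
  have dB (n : ℕ) (x : boundedCochains X R n) : (boundedComplex X R).d n (n + 1) x =
      (coboundary X R n).restrict (coboundary_mem_boundedCochains X R n) x :=
    subcomplex_d_apply _ _ n x
  rw [CategoryTheory.isIso_iff_mono_and_epi]
  rcases n with - | n
  · constructor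
    · refine mono_homologyMap_of_forall_exists _ CochainComplex.prev_nat_zero
        (CochainComplex.next ℕ 0) fun (x : coarseCochains X R 0) hx y hy => ⟨0, ?_⟩
      rw [HomologicalComplex.shape _ _ _ (by simp)] at hy
      have hx0 : x.1 = 0 := congrArg Subtype.val hy
      rw [map_zero]
      exact Subtype.ext hx0
    · refine epi_homologyMap_of_forall_exists _ CochainComplex.prev_nat_zero
        (CochainComplex.next ℕ 0) fun (y : boundedCochains X R 0) hy => ?_
      have hy0 : coboundary X R 0 y.1 = 0 := congrArg Subtype.val ((dB 0 y).symm.trans hy)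
      have hm := hX.mem_coarseCochains_zero y.2 (by rw [hy0]; exact zero_mem _)
      refine ⟨(⟨y.1, hm⟩ : coarseCochains X R 0), ?_, 0, ?_⟩
      · exact (dC 0 _).trans (Subtype.ext hy0)
      · rw [map_zero, add_zero]
        rfl
  · constructor
    · refine mono_homologyMap_of_forall_exists _ (CochainComplex.prev_nat_succ n)
        (CochainComplex.next ℕ (n + 1))
        fun (x : coarseCochains X R (n + 1)) hx (y : boundedCochains X R n) hy => ?_
      have hxy : x.1 = coboundary X R n y.1 := congrArg Subtype.val (hy.trans (dB n y))
      rcases n with - | n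
      · refine ⟨(⟨y.1, hX.mem_coarseCochains_zero y.2 (hxy ▸ x.2)⟩ : coarseCochains X R 0), ?_⟩
        exact (Subtype.ext hxy).trans (dC 0 _).symm
      -- Subtracting the coboundary of `ψ` makes the primitive `y` of `x` coarse without changing
      -- its coboundary.
      · obtain ⟨ψ, -, hψ⟩ := hX.exists_sub_coboundary_mem_coarseCochains y.2 (hxy ▸ x.2)
        refine ⟨(⟨_, hψ⟩ : coarseCochains X R (n + 1)),
          (Subtype.ext (hxy.trans ?_)).trans (dC (n + 1) _).symm⟩
        change _ = coboundary X R (n + 1) (y.1 - coboundary X R n ψ)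
        rw [map_sub, coboundary_coboundary, sub_zero]
    · refine epi_homologyMap_of_forall_exists _ (CochainComplex.prev_nat_succ n)
        (CochainComplex.next ℕ (n + 1)) fun (y : boundedCochains X R (n + 1)) hy => ?_
      have hy0 : coboundary X R (n + 1) y.1 = 0 :=
        congrArg Subtype.val ((dB (n + 1) y).symm.trans hy)
      obtain ⟨ψ, hψB, hψ⟩ := hX.exists_sub_coboundary_mem_coarseCochains y.2
        (by rw [hy0]; exact zero_mem _)
      refine ⟨(⟨_, hψ⟩ : coarseCochains X R (n + 1)), (dC (n + 1) _).trans (Subtype.ext ?_),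
        (⟨ψ, hψB⟩ : boundedCochains X R n), ?_⟩
      · change coboundary X R (n + 1) (y.1 - coboundary X R n ψ) = 0
        rw [map_sub, coboundary_coboundary, hy0, sub_zero]
      · erw [dB]
        exact Subtype.ext (sub_add_cancel y.1 _).symm
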